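/- Let $m\ge 0$ and let $M\subset\mathbb{R}^{m+1}$ be an oriented $m$-dimensional smooth (embedded) submanifold, i.e. an oriented smooth hypersurface. Its Gauss map is $\mathfrak{T}\colon M\to\bigwedge^m\mathbb{R}^{m+1}$, $\mathfrak{T}(x)=\tau_1\wedge\dots\wedge\tau_m$, where $\tau_1,\dots,\tau_m$ is an orthonormal basis of $T_xM$ compatible with the orientation (so $\mathfrak{T}$ is continuous). Equip $\bigwedge^m\mathbb{R}^{m+1}$ with the inner product determined by $\langle a_1\wedge\dots\wedge a_m,\,b_1\wedge\dots\wedge b_m\rangle=\det(\langle a_i,b_j\rangle)$; a unit $m$-blade is a simple $m$-vector $a_1\wedge\dots\wedge a_m$ of norm $1$. Let $n$ be the unit normal field of $M$ with $\mathfrak{T}\wedge n=e_1\wedge\dots\wedge e_{m+1}$, and let $D_a$ denote the directional derivative on $M$ in the direction $a\in T_xM$. The mean curvature is $\mathcal{H}=-\sum_{j}\langle\tau_j,D_{\tau_j}n\rangle$; the second fundamental form is $\mathrm{B}(a,b)=(D_a\tilde b)^{\perp}$ for $a,b\in T_xM$, where $\tilde b$ is any tangent vector field extending $b$ and $\perp$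 denotes the normal part, and $|\mathrm{B}|^2=\sum_{j,l=1}^m|\mathrm{B}(\tau_l,\tau_j)|^2$. Finally $\Delta_M\varphi=\operatorname{div}_M\operatorname{grad}_M\varphi$ is the Laplace–Beltrami operator of $M$, with $\operatorname{grad}_M\varphi=\sum_j(D_{\tau_j}\varphi)\,\tau_j$ and $\operatorname{div}_MX=\sum_j\langle\tau_j,D_{\tau_j}X\rangle$. Suppose that $M$ has constant mean curvature, i.e. $\mathcal{H}$ is constant on $M$, and that for some fixed unit $m$-blade $I\in\bigwedge^m\mathbb{R}^{m+1}$ one has $\langle\mathfrak{T}(x),I\rangle>0$ for all $x\in M$. Then $$-\Delta_M\ln\langle\mathfrak{T},I\rangle\;\ge\;|\mathrm{B}|^2\qquad\text{on } M.$$ -/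

import Mathlib

open scoped ContDiff Topology

noncomputable section

namespace HypersurfaceGaussMap

/-- `M` is an `m`-dimensional smooth (embedded) submanifold of `ℝᴺ`: around each of its points,
a local diffeomorphism of `ℝᴺ` straightens `M` to an `m`-dimensional linear subspace `L`. -/
def IsSmoothSubmanifold {N : ℕ} (m : ℕ) (M : Set (EuclideanSpace ℝ (Fin N))) : Prop :=
  ∀ x ∈ M, ∃ (e : OpenPartialHomeomorph (EuclideanSpace ℝ (Fin N)) (EuclideanSpace ℝ (Fin N)))
    (L : Submodule ℝ (EuclideanSpace ℝ (Fin N))),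
    x ∈ e.source ∧ Module.finrank ℝ L = m ∧
    ContDiffOn ℝ ∞ e e.source ∧ ContDiffOn ℝ ∞ e.symm e.target ∧
    ∀ y ∈ e.source, (y ∈ M ↔ e y ∈ L)

/-- `T_x M`, the space of velocities `γ'(0)` of curves `γ` in `M` with `γ(0) = x`. (For a
submanifold the velocities already form a linear subspace; the span makes it a `Submodule`.) -/
def tangentSpace {N : ℕ} (M : Set (EuclideanSpace ℝ (Fin N))) (x : EuclideanSpace ℝ (Fin N)) :
    Submodule ℝ (EuclideanSpace ℝ (Fin N)) :=
  Submodule.span ℝ {a | ∃ γ : ℝ → EuclideanSpace ℝ (Fin N),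
    (∀ᶠ t in 𝓝 0, γ t ∈ M) ∧ γ 0 = x ∧ HasDerivAt γ a 0}

/-- An orthonormal basis `τ₁, …, τ_d` of `T_x M`. The operators below do not depend on it. -/
def frame {N : ℕ} (M : Set (EuclideanSpace ℝ (Fin N))) (x : EuclideanSpace ℝ (Fin N)) :
    OrthonormalBasis (Fin (Module.finrank ℝ (tangentSpace M x))) ℝ (tangentSpace M x) :=
  stdOrthonormalBasis ℝ (tangentSpace M x)

/-- The directional derivative at `x ∈ M`, in the tangent direction `a ∈ T_x M`, of a function
`F` on `M` (the values of `F` off `M` play no role). On tangent vectors it is the derivative of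
`F` along curves in `M`, see `hasDerivAt_dirDeriv`. -/
def dirDeriv {N : ℕ} {W : Type*} [NormedAddCommGroup W] [NormedSpace ℝ W]
    (M : Set (EuclideanSpace ℝ (Fin N))) (F : EuclideanSpace ℝ (Fin N) → W)
    (x a : EuclideanSpace ℝ (Fin N)) : W :=
  fderivWithin ℝ F M x a

theorem hasDerivAt_dirDeriv {N : ℕ} {W : Type*} [NormedAddCommGroup W] [NormedSpace ℝ W]
    {M : Set (EuclideanSpace ℝ (Fin N))} {F : EuclideanSpace ℝ (Fin N) → W}
    {x a : EuclideanSpace ℝ (Fin N)} {γ : ℝ → EuclideanSpace ℝ (Fin N)}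
    (hF : DifferentiableWithinAt ℝ F M x) (hγM : ∀ᶠ t in 𝓝 0, γ t ∈ M) (hγx : γ 0 = x)
    (hγ : HasDerivAt γ a 0) : HasDerivAt (F ∘ γ) (dirDeriv M F x a) 0 :=
  hF.hasFDerivWithinAt.comp_hasDerivAt_of_eq 0 hγ hγM hγx.symm

/-- The surface gradient `∂φ = ∑ⱼ (D_{τⱼ} φ) τⱼ` of a real function `φ` on `M`. -/
def surfaceGrad {N : ℕ} (M : Set (EuclideanSpace ℝ (Fin N)))
    (φ : EuclideanSpace ℝ (Fin N) → ℝ) (x : EuclideanSpace ℝ (Fin N)) :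
    EuclideanSpace ℝ (Fin N) :=
  ∑ j, dirDeriv M φ x (frame M x j) • (frame M x j : EuclideanSpace ℝ (Fin N))

/-- The surface divergence `∂ · X = ∑ⱼ ⟨τⱼ, D_{τⱼ} X⟩` of an `ℝᴺ`-valued function `X` on `M`. -/
def surfaceDiv {N : ℕ} (M : Set (EuclideanSpace ℝ (Fin N)))
    (X : EuclideanSpace ℝ (Fin N) → EuclideanSpace ℝ (Fin N))
    (x : EuclideanSpace ℝ (Fin N)) : ℝ :=
  ∑ j, inner ℝ (frame M x j : EuclideanSpace ℝ (Fin N)) (dirDeriv M X x (frame M x j))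

/-- The Laplace–Beltrami operator `Δ_M φ = div_M grad_M φ` on real functions on `M`. -/
def laplaceBeltrami {N : ℕ} (M : Set (EuclideanSpace ℝ (Fin N)))
    (φ : EuclideanSpace ℝ (Fin N) → ℝ) (x : EuclideanSpace ℝ (Fin N)) : ℝ :=
  surfaceDiv M (surfaceGrad M φ) x

/-- The second fundamental form `B_x(a, b) = (D_a b̃)^⊥` for `a, b ∈ T_x M`, where `b̃` is the
tangent vector field `b̃(y) = P_y b` extending `b`, with `P_y` the orthogonal projection onto
`T_y M`. -/
def secondFundamentalForm {N : ℕ} (M : Set (EuclideanSpace ℝ (Fin N)))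
    (x a b : EuclideanSpace ℝ (Fin N)) : EuclideanSpace ℝ (Fin N) :=
  (tangentSpace M x)ᗮ.starProjection
    (dirDeriv M (fun y => (tangentSpace M y).starProjection b) x a)

/-- The squared norm `|B|² = ∑_{j,l} |B(τ_l, τⱼ)|²` of the second fundamental form. -/
def normSqB {N : ℕ} (M : Set (EuclideanSpace ℝ (Fin N))) (x : EuclideanSpace ℝ (Fin N)) : ℝ :=
  ∑ j, ∑ l, ‖secondFundamentalForm M x (frame M x l) (frame M x j)‖ ^ 2

/-- `T` is the Gauss map of the `m`-dimensional submanifold `M` for some orientation of `M`: a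
continuous choice of `T(x) = τ₁ ∧ … ∧ τ_m` with `τ₁, …, τ_m` an orthonormal basis of `T_x M`. -/
structure IsGaussMap {N m : ℕ} (M : Set (EuclideanSpace ℝ (Fin N)))
    (T : EuclideanSpace ℝ (Fin N) → ⋀[ℝ]^m (EuclideanSpace ℝ (Fin N))) : Prop where
  continuousOn : ContinuousOn T M
  eq_wedge : ∀ x ∈ M, ∃ τ : OrthonormalBasis (Fin m) ℝ (tangentSpace M x),
    T x = exteriorPower.ιMulti ℝ m (fun j => (τ j : EuclideanSpace ℝ (Fin N)))

/-- A unit `m`-blade: a simple `m`-vector `a₁ ∧ … ∧ a_m` of norm one. -/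
def IsUnitBlade {N m : ℕ} (A : ⋀[ℝ]^m (EuclideanSpace ℝ (Fin N))) : Prop :=
  (∃ a : Fin m → EuclideanSpace ℝ (Fin N), A = exteriorPower.ιMulti ℝ m a) ∧ ‖A‖ = 1

/-- `n` is the unit normal field of the hypersurface `M` oriented by `T`: at each `x ∈ M`, `n(x)`
is the unit normal vector with `T(x) ∧ n(x) = e₁ ∧ … ∧ e_{m+1}`. -/
structure IsUnitNormal {m : ℕ} (M : Set (EuclideanSpace ℝ (Fin (m + 1))))
    (T : EuclideanSpace ℝ (Fin (m + 1)) → ⋀[ℝ]^m (EuclideanSpace ℝ (Fin (m + 1))))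
    (n : EuclideanSpace ℝ (Fin (m + 1)) → EuclideanSpace ℝ (Fin (m + 1))) : Prop where
  mem_normal : ∀ x ∈ M, n x ∈ (tangentSpace M x)ᗮ
  norm_eq_one : ∀ x ∈ M, ‖n x‖ = 1
  wedge_eq : ∀ x ∈ M,
    (T x : ExteriorAlgebra ℝ (EuclideanSpace ℝ (Fin (m + 1)))) * ExteriorAlgebra.ι ℝ (n x) =
      ExteriorAlgebra.ιMulti ℝ (m + 1)
        (fun i => EuclideanSpace.basisFun (Fin (m + 1)) ℝ i)

/-- The mean curvature `H = - ∂ · n` (no factor `1/m`) of a hypersurface with unit normal `n`. -/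
def meanCurvature {m : ℕ} (M : Set (EuclideanSpace ℝ (Fin (m + 1))))
    (n : EuclideanSpace ℝ (Fin (m + 1)) → EuclideanSpace ℝ (Fin (m + 1)))
    (x : EuclideanSpace ℝ (Fin (m + 1))) : ℝ :=
  -surfaceDiv M n x

/-- The hypersurface `M`, oriented by its Gauss map `T`, has constant mean curvature. (Its unit
normal field `n` exists and is unique on `M`.) -/
def HasConstantMeanCurvature {m : ℕ} (M : Set (EuclideanSpace ℝ (Fin (m + 1))))
    (T : EuclideanSpace ℝ (Fin (m + 1)) → ⋀[ℝ]^m (EuclideanSpace ℝ (Fin (m + 1)))) : Prop :=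
  ∃ n, IsUnitNormal M T n ∧ ∃ c : ℝ, ∀ x ∈ M, meanCurvature M n x = c

end HypersurfaceGaussMap

end

/-! By Hodge duality the pairing of the Gauss map with the blade is u = ⟨n, v⟩ for a fixed vector v
(`exists_inner_unitNormal_eq`), so the claim concerns the height of the unit normal. The classical
computation gives grad u = A w, where A = Dn is minus the shape operator and w is the tangential
part of v. Codazzi together with constant mean curvature then gives Δu = -|B|² u. Hence Δ ln u =
-|B|² - |grad ln u|² (`laplaceBeltrami_log`), and dropping the square proves the inequality.

No charts or connection are needed. Near each point n extends to a smooth unit field N on an open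
set of the ambient space (`exists_isLocalUnitNormal`), and tangential derivatives along M are
restrictions of ambient ones (`dirDeriv_eq_of_eventuallyEq`). Codazzi becomes the symmetry of D²N.
-/

open scoped ContDiff Topology

namespace HypersurfaceGaussMap

/-- On tangent vectors, `dirDeriv` agrees with the derivative of any differentiable function on
the ambient space that has the same values on `M` near `x`. -/
theorem dirDeriv_eq_of_eventuallyEq {N : ℕ} {W : Type*} [NormedAddCommGroup W] [NormedSpace ℝ W]
    {M : Set (EuclideanSpace ℝ (Fin N))} {F G : EuclideanSpace ℝ (Fin N) → W}
    {G' : EuclideanSpace ℝ (Fin N) →L[ℝ] W} {x a : EuclideanSpace ℝ (Fin N)}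
    (hG : HasFDerivAt G G' x) (hFG : F =ᶠ[𝓝[M] x] G) (hx : x ∈ M)
    (ha : a ∈ tangentSpace M x) : dirDeriv M F x a = G' a := by
  have hF : HasFDerivWithinAt F G' M x :=
    hG.hasFDerivWithinAt.congr_of_eventuallyEq hFG (hFG.self_of_nhdsWithin hx)
  unfold tangentSpace at ha
  induction ha using Submodule.span_induction with
  | mem a ha =>
    obtain ⟨γ, hγM, hγx, hγ⟩ := ha
    -- `fderivWithin` along a hypersurface is a choice, determined only on tangent vectors: there
    -- both candidates differentiate `F ∘ γ`.
    exact (hasDerivAt_dirDeriv hF.differentiableWithinAt hγM hγx hγ).unique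
      (hF.comp_hasDerivAt_of_eq 0 hγ hγM hγx.symm)
  | zero => simp [dirDeriv]
  | add a b _ _ iha ihb =>
    simp only [dirDeriv, map_add] at *
    rw [iha, ihb]
  | smul c a _ iha =>
    simp only [dirDeriv, map_smul] at *
    rw [iha]

/-! ### Hodge duality: from the Gauss map to the unit normal -/

theorem exteriorAlgebra_ιMulti_snoc {V : Type*} [AddCommGroup V] [Module ℝ V] {m : ℕ}
    (a : Fin m → V) (v : V) :
    ExteriorAlgebra.ιMulti ℝ (m + 1) (Fin.snoc (α := fun _ => V) a v) =
      ExteriorAlgebra.ιMulti ℝ m a * ExteriorAlgebra.ι ℝ v := by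
  rw [ExteriorAlgebra.ιMulti_apply, ExteriorAlgebra.ιMulti_apply, List.ofFn_succ',
    List.concat_eq_append, List.prod_append]
  simp

/-- Laplace expansion of the Gram determinant along its last column, whose entries are ⟨n, tᵢ⟩ = 0
and ⟨n, n⟩ = 1. -/
theorem inner_ιMulti_snoc {V : Type*} [NormedAddCommGroup V] [InnerProductSpace ℝ V]
    [FiniteDimensional ℝ V] {m : ℕ} (a t : Fin m → V) (n : V) (hn : ‖n‖ = 1)
    (ht : ∀ i, inner ℝ (t i) n = 0) :
    inner ℝ (exteriorPower.ιMulti ℝ (m + 1) (Fin.snoc (α := fun _ => V) a n))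
      (exteriorPower.ιMulti ℝ (m + 1) (Fin.snoc (α := fun _ => V) t n)) =
      inner ℝ (exteriorPower.ιMulti ℝ m t) (exteriorPower.ιMulti ℝ m a) := by
  rw [real_inner_comm (exteriorPower.ιMulti ℝ m a), exteriorPower.inner_ιMulti_ιMulti,
    exteriorPower.inner_ιMulti_ιMulti, Matrix.det_succ_column _ (Fin.last m),
    Fin.sum_univ_castSucc, Finset.sum_eq_zero]
  · simp only [Matrix.of_apply, Fin.snoc_last, real_inner_self_eq_norm_sq, hn, zero_add]
    simp only [one_pow, mul_one, ← two_mul, pow_mul, neg_one_sq, Fin.succAbove_last, one_mul,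
      Fin.val_last]
    congr 1
    ext i j
    simp
  · intro i _
    simp [real_inner_comm (t i), ht]

/-- The Hodge dual of `a₁ ∧ … ∧ a_m` with respect to an `(m + 1)`-vector. -/
theorem exists_inner_eq_inner_ιMulti_snoc {V : Type*} [NormedAddCommGroup V]
    [InnerProductSpace ℝ V] [FiniteDimensional ℝ V] {m : ℕ} (a : Fin m → V)
    (E : ⋀[ℝ]^(m + 1) V) :
    ∃ v : V, ∀ w, inner ℝ w v =
      inner ℝ (exteriorPower.ιMulti ℝ (m + 1) (Fin.snoc (α := fun _ => V) a w)) E := by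
  have : CompleteSpace V := FiniteDimensional.complete ℝ V
  let ℓ : V →ₗ[ℝ] ℝ := (innerₗ _ E) ∘ₗ
    (exteriorPower.ιMulti ℝ (m + 1)).toMultilinearMap.toLinearMap
      (Fin.snoc (α := fun _ => V) a 0) (Fin.last m)
  refine ⟨(InnerProductSpace.toDual ℝ V).symm ℓ.toContinuousLinearMap, fun w => ?_⟩
  rw [real_inner_comm, InnerProductSpace.toDual_symm_apply, real_inner_comm]
  have h : Function.update (Fin.snoc (α := fun _ => V) a 0) (Fin.last m) w =
      Fin.snoc (α := fun _ => V) a w := Fin.update_snoc_last (α := fun _ => V) 0 a w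
  rw [← h]
  rfl

/-- Up to the Hodge star, the pairing of the Gauss map with a fixed blade is the pairing of the
unit normal with a fixed vector. -/
theorem exists_inner_unitNormal_eq {m : ℕ} {M : Set (EuclideanSpace ℝ (Fin (m + 1)))}
    {T : EuclideanSpace ℝ (Fin (m + 1)) → ⋀[ℝ]^m (EuclideanSpace ℝ (Fin (m + 1)))}
    {n : EuclideanSpace ℝ (Fin (m + 1)) → EuclideanSpace ℝ (Fin (m + 1))}
    (hT : IsGaussMap M T) (hn : IsUnitNormal M T n)
    (a : Fin m → EuclideanSpace ℝ (Fin (m + 1))) :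
    ∃ v : EuclideanSpace ℝ (Fin (m + 1)), ∀ y ∈ M,
      inner ℝ (T y) (exteriorPower.ιMulti ℝ m a) = inner ℝ (n y) v := by
  obtain ⟨v, hv⟩ := exists_inner_eq_inner_ιMulti_snoc a (exteriorPower.ιMulti ℝ (m + 1)
    (fun i => EuclideanSpace.basisFun (Fin (m + 1)) ℝ i))
  refine ⟨v, fun y hy => ?_⟩
  obtain ⟨τ, hτ⟩ := hT.eq_wedge y hy
  -- The volume element is τ₁ ∧ … ∧ τ_m ∧ n(y) at every y, so pairing it with a ∧ n(y) leaves ⟨a,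
  -- τ⟩.
  have hE : exteriorPower.ιMulti ℝ (m + 1)
      (fun i => EuclideanSpace.basisFun (Fin (m + 1)) ℝ i) = exteriorPower.ιMulti ℝ (m + 1)
      (Fin.snoc (α := fun _ => EuclideanSpace ℝ (Fin (m + 1)))
        (fun j => (τ j : EuclideanSpace ℝ (Fin (m + 1)))) (n y)) := by
    apply Subtype.ext
    rw [exteriorPower.ιMulti_apply_coe, exteriorPower.ιMulti_apply_coe,
      exteriorAlgebra_ιMulti_snoc, ← hn.wedge_eq y hy, hτ, exteriorPower.ιMulti_apply_coe]
  rw [hv, hE, hτ]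
  exact (inner_ιMulti_snoc a (fun j => (τ j : EuclideanSpace ℝ (Fin (m + 1)))) (n y)
    (hn.norm_eq_one y hy) (fun i => hn.mem_normal y hy _ (τ i).2)).symm

theorem finrank_tangentSpace_of_isGaussMap {N m : ℕ} {M : Set (EuclideanSpace ℝ (Fin N))}
    {T : EuclideanSpace ℝ (Fin N) → ⋀[ℝ]^m (EuclideanSpace ℝ (Fin N))}
    (hT : IsGaussMap M T) {x : EuclideanSpace ℝ (Fin N)} (hx : x ∈ M) :
    Module.finrank ℝ (tangentSpace M x) = m := by
  obtain ⟨τ, -⟩ := hT.eq_wedge x hx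
  simpa using Module.finrank_eq_card_basis τ.toBasis

/-- The trace of an operator over the hyperplane normal to a unit vector `n`. -/
theorem sum_inner_orthonormalBasis_hyperplane {V ι κ : Type*} [NormedAddCommGroup V]
    [InnerProductSpace ℝ V] [FiniteDimensional ℝ V] [Fintype ι] [Fintype κ]
    {S : Submodule ℝ V} (b : OrthonormalBasis ι ℝ S) (e : OrthonormalBasis κ ℝ V) {n : V}
    (hP : ∀ v, S.starProjection v = v - inner ℝ n v • n) (A : V →L[ℝ] V) :
    ∑ j, inner ℝ (b j : V) (A (b j)) = ∑ i, inner ℝ (e i) (A (e i)) - inner ℝ n (A n) := by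
  have h1 : ∀ j, inner ℝ (b j : V) (A (b j)) =
      ∑ i, inner ℝ (e i) (b j : V) * inner ℝ (b j : V) (A (e i)) := fun j => by
    conv_lhs => rw [← e.sum_repr' (b j : V)]
    rw [map_sum, ← e.sum_repr' (b j : V), inner_sum]
    simp [inner_smul_right, e.sum_repr']
  have h2 : ∀ i, ∑ j, inner ℝ (e i) (b j : V) * inner ℝ (b j : V) (A (e i)) =
      inner ℝ (e i) (A (e i)) - inner ℝ (e i) n * inner ℝ n (A (e i)) := fun i => by
    have h3 : ∑ j, inner ℝ (b j : V) (A (e i)) • (b j : V) = S.starProjection (A (e i)) := by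
      simp [b.starProjection_eq_sum_rankOne]
    have h4 := congrArg (inner ℝ (e i)) h3
    rw [hP, inner_sum, inner_sub_right] at h4
    simp only [inner_smul_right] at h4
    rw [mul_comm (inner ℝ (e i) n), ← h4]
    exact Finset.sum_congr rfl fun j _ => mul_comm _ _
  rw [Finset.sum_congr rfl fun j _ => h1 j, Finset.sum_comm, Finset.sum_congr rfl fun i _ => h2 i,
    Finset.sum_sub_distrib]
  congr 1
  conv_rhs => rw [← e.sum_repr' n, map_sum, e.sum_repr' n, inner_sum]
  simp [inner_smul_right]

/-! ### Local defining functions and smooth unit normals -/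

/-- A submanifold of positive codimension lies locally in a level set of a submersion to `ℝ`. -/
theorem exists_local_defining_function {m : ℕ} {M : Set (EuclideanSpace ℝ (Fin (m + 1)))}
    (hM : IsSmoothSubmanifold m M) {x : EuclideanSpace ℝ (Fin (m + 1))} (hx : x ∈ M) :
    ∃ (U : Set (EuclideanSpace ℝ (Fin (m + 1)))) (f : EuclideanSpace ℝ (Fin (m + 1)) → ℝ),
      IsOpen U ∧ x ∈ U ∧ ContDiffOn ℝ ∞ f U ∧ (∀ y ∈ U, gradient f y ≠ 0) ∧
      ∀ y ∈ M ∩ U, f y = 0 := by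
  obtain ⟨e, L, hxe, hL, he, hes, heM⟩ := hM x hx
  have hne : Lᗮ ≠ ⊥ := fun h => by
    have := L.finrank_add_finrank_orthogonal
    rw [h, hL, finrank_bot, finrank_euclideanSpace_fin] at this
    omega
  obtain ⟨w, hwL, hw⟩ := Submodule.exists_mem_ne_zero_of_ne_bot hne
  refine ⟨e.source, fun y => inner ℝ w (e y), e.open_source, hxe, contDiffOn_const.inner ℝ he,
    fun y hy h0 => ?_, fun y hy => ?_⟩
  · have hdy : DifferentiableAt ℝ e y :=
      (he.contDiffAt (e.open_source.mem_nhds hy)).differentiableAt (by simp)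
    have hds : DifferentiableAt ℝ e.symm (e y) :=
      (hes.contDiffAt (e.open_target.mem_nhds (e.map_source hy))).differentiableAt (by simp)
    have hds' := hds.hasFDerivAt
    have hdy' : HasFDerivAt e (fderiv ℝ e y) (e.symm (e y)) := by
      rw [e.left_inv hy]; exact hdy.hasFDerivAt
    have hcomp := hdy'.comp (e y) hds'
    have hid : HasFDerivAt (e ∘ e.symm) (ContinuousLinearMap.id ℝ _) (e y) :=
      (hasFDerivAt_id _).congr_of_eventuallyEq (by
        filter_upwards [e.open_target.mem_nhds (e.map_source hy)] with z hz
        exact e.right_inv hz)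
    have hsurj := congrArg (fun A => A w) (hcomp.unique hid)
    have hf : HasFDerivAt (fun y => inner ℝ w (e y)) ((innerSL ℝ w).comp (fderiv ℝ e y)) y :=
      (innerSL ℝ w).hasFDerivAt.comp y hdy.hasFDerivAt
    have hzero : fderiv ℝ (fun y => inner ℝ w (e y)) y = 0 := by
      rw [gradient] at h0
      simpa using h0
    rw [hf.fderiv] at hzero
    -- In the direction (De)⁻¹ w the function ⟨w, e⟩ has derivative |w|², which cannot vanish.
    have := congrArg (fun A => A (fderiv ℝ e.symm (e y) w)) hzero
    simp only [ContinuousLinearMap.comp_apply, ContinuousLinearMap.id_apply] at hsurj this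
    rw [hsurj] at this
    simp at this
    exact hw this
  · exact Submodule.inner_left_of_mem_orthogonal ((heM y hy.2).1 hy.1) hwL

theorem gradient_mem_orthogonal_tangentSpace {N : ℕ} {M U : Set (EuclideanSpace ℝ (Fin N))}
    {f : EuclideanSpace ℝ (Fin N) → ℝ} (hU : IsOpen U) (hf : ∀ y ∈ M ∩ U, f y = 0)
    {y : EuclideanSpace ℝ (Fin N)} (hy : y ∈ M ∩ U) (hd : DifferentiableAt ℝ f y) :
    gradient f y ∈ (tangentSpace M y)ᗮ := by
  rw [Submodule.mem_orthogonal]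
  intro a ha
  have h0 : (fun _ => (0 : ℝ)) =ᶠ[𝓝[M] y] f := by
    filter_upwards [self_mem_nhdsWithin, mem_nhdsWithin_of_mem_nhds (hU.mem_nhds hy.2)]
      with z hz hzU
    exact (hf z ⟨hz, hzU⟩).symm
  have h1 := dirDeriv_eq_of_eventuallyEq hd.hasFDerivAt h0 hy.1 ha
  rw [real_inner_comm, inner_gradient_left, ← h1]
  simp [dirDeriv]

/-- `N` is a smooth unit vector field on the open set `U` of the ambient space that is normal
to `M` and has symmetric derivative (the shape operator up to sign) along `M`. -/
structure IsLocalUnitNormal {d : ℕ} (M U : Set (EuclideanSpace ℝ (Fin d)))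
    (N : EuclideanSpace ℝ (Fin d) → EuclideanSpace ℝ (Fin d)) : Prop where
  isOpen : IsOpen U
  contDiffOn : ContDiffOn ℝ ∞ N U
  norm_eq_one : ∀ y ∈ U, ‖N y‖ = 1
  tangentSpace_eq : ∀ y ∈ M ∩ U, tangentSpace M y = (ℝ ∙ N y)ᗮ
  symm : ∀ y ∈ M ∩ U, ∀ a ∈ tangentSpace M y, ∀ b ∈ tangentSpace M y,
    inner ℝ (fderiv ℝ N y a) b = inner ℝ (fderiv ℝ N y b) a

theorem hasFDerivAt_clm_apply_const {E F G : Type*} [NormedAddCommGroup E] [NormedSpace ℝ E]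
    [NormedAddCommGroup F] [NormedSpace ℝ F] [NormedAddCommGroup G] [NormedSpace ℝ G]
    {f : E → F →L[ℝ] G} {f' : E →L[ℝ] F →L[ℝ] G} {x : E} (h : HasFDerivAt f f' x) (b : F) :
    HasFDerivAt (fun z => f z b) (f'.flip b) x :=
  (ContinuousLinearMap.apply ℝ G b).hasFDerivAt.comp x h

/-- Differentiating the factor 1/|∇f| yields a multiple of ∇f, which b annihilates. What remains is
the Hessian of f, whose symmetry makes the shape operator self-adjoint. -/
theorem inner_fderiv_normalize_gradient {d : ℕ} {f : EuclideanSpace ℝ (Fin d) → ℝ}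
    {y : EuclideanSpace ℝ (Fin d)} (hf : ContDiffAt ℝ ∞ f y) (h0 : gradient f y ≠ 0)
    {a b : EuclideanSpace ℝ (Fin d)} (hb : inner ℝ (gradient f y) b = 0) :
    inner ℝ (fderiv ℝ (fun z => ‖gradient f z‖⁻¹ • gradient f z) y a) b =
      ‖gradient f y‖⁻¹ * fderiv ℝ (fderiv ℝ f) y a b := by
  have hf2 : DifferentiableAt ℝ (fderiv ℝ f) y :=
    (hf.fderiv_right (m := 1) (by norm_num; exact ENat.LEInfty.out)).differentiableAt (by simp)
  have hg : DifferentiableAt ℝ (gradient f) y :=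
    (InnerProductSpace.toDual ℝ (EuclideanSpace ℝ (Fin d))).symm.differentiableAt.comp y hf2
  have hr : DifferentiableAt ℝ (fun z => ‖gradient f z‖⁻¹) y :=
    (hg.norm ℝ h0).inv (norm_ne_zero_iff.2 h0)
  have hgb : inner ℝ (fderiv ℝ (gradient f) y a) b = fderiv ℝ (fderiv ℝ f) y a b := by
    have h1 : (fun z => inner ℝ (gradient f z) b) = fun z => fderiv ℝ f z b := by
      ext z
      simp [gradient]
    have h2 := fderiv_inner_apply ℝ hg (differentiableAt_const b) a
    have h3 : HasFDerivAt (fun z => fderiv ℝ f z b) ((fderiv ℝ (fderiv ℝ f) y).flip b) y :=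
      hasFDerivAt_clm_apply_const hf2.hasFDerivAt b
    rw [h1, h3.fderiv] at h2
    simpa using h2.symm
  rw [fderiv_fun_smul hr hg]
  simp [inner_add_left, inner_smul_left, hb, hgb]

/-- The unit normals of a smooth hypersurface on a prescribed side extend locally to a smooth
unit field. -/
theorem exists_isLocalUnitNormal {m : ℕ} {M : Set (EuclideanSpace ℝ (Fin (m + 1)))}
    (hM : IsSmoothSubmanifold m M)
    (hfr : ∀ y ∈ M, Module.finrank ℝ (tangentSpace M y) = m)
    {n : EuclideanSpace ℝ (Fin (m + 1)) → EuclideanSpace ℝ (Fin (m + 1))}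
    (hn : ∀ y ∈ M, n y ∈ (tangentSpace M y)ᗮ) (hn1 : ∀ y ∈ M, ‖n y‖ = 1)
    {v : EuclideanSpace ℝ (Fin (m + 1))} (hv : ∀ y ∈ M, 0 < inner ℝ (n y) v)
    {x : EuclideanSpace ℝ (Fin (m + 1))} (hx : x ∈ M) :
    ∃ U N, x ∈ U ∧ IsLocalUnitNormal M U N ∧ ∀ y ∈ M ∩ U, n y = N y := by
  obtain ⟨U₀, f₀, hU₀, hxU₀, hf₀, hg₀, hz₀⟩ := exists_local_defining_function hM hx
  have hfr' : ∀ y ∈ M, Module.finrank ℝ (tangentSpace M y)ᗮ = 1 := fun y hy => by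
    have := (tangentSpace M y).finrank_add_finrank_orthogonal
    rw [hfr y hy, finrank_euclideanSpace_fin] at this
    omega
  have hcoll : ∀ y ∈ M, ∀ g ∈ (tangentSpace M y)ᗮ, ∃ c : ℝ, g = c • n y := by
    intro y hy g hg
    have hny : (⟨n y, hn y hy⟩ : (tangentSpace M y)ᗮ) ≠ 0 := fun h => by
      have := hn1 y hy
      rw [Submodule.mk_eq_zero] at h
      simp [h] at this
    obtain ⟨c, hc⟩ := (finrank_eq_one_iff_of_nonzero' _ hny).1 (hfr' y hy) ⟨g, hg⟩
    exact ⟨c, (congrArg Subtype.val hc).symm⟩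
  -- If ∇f₀(x) = c n(x), then f = c f₀ has gradient c² n(x) at x, on the same side as n.
  obtain ⟨f, hf, hg, hz, hxv⟩ : ∃ f : EuclideanSpace ℝ (Fin (m + 1)) → ℝ, ContDiffOn ℝ ∞ f U₀ ∧
      (∀ y ∈ U₀, gradient f y ≠ 0) ∧ (∀ y ∈ M ∩ U₀, f y = 0) ∧
      0 < inner ℝ (gradient f x) v := by
    have hd : DifferentiableAt ℝ f₀ x :=
      (hf₀.contDiffAt (hU₀.mem_nhds hxU₀)).differentiableAt (by simp)
    obtain ⟨c, hc⟩ := hcoll x hx _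
      (gradient_mem_orthogonal_tangentSpace hU₀ hz₀ ⟨hx, hxU₀⟩ hd)
    have hgrad : ∀ y, gradient (fun z => c * f₀ z) y = c • gradient f₀ y := fun y => by
      have : fderiv ℝ (fun z => c * f₀ z) y = c • fderiv ℝ f₀ y :=
        congrFun (fderiv_const_smul_field (f := f₀) c) y
      simp [gradient, this]
    have hc0 : c ≠ 0 := by
      rintro rfl
      exact hg₀ x hxU₀ (by simpa using hc)
    refine ⟨fun z => c * f₀ z, contDiffOn_const.mul hf₀, fun y hy => ?_, fun y hy => ?_, ?_⟩
    · rw [hgrad]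
      exact smul_ne_zero hc0 (hg₀ y hy)
    · simp [hz₀ y hy]
    · rw [hgrad, hc, smul_smul, inner_smul_left]
      exact mul_pos (by simpa using mul_self_pos.2 hc0) (hv x hx)
  have hgsmooth : ContDiffOn ℝ ∞ (gradient f) U₀ :=
    (InnerProductSpace.toDual ℝ (EuclideanSpace ℝ (Fin (m + 1)))).symm.contDiff.comp_contDiffOn
      (hf.fderiv_of_isOpen hU₀ (by simp))
  have hvcont : ContinuousOn (fun y => inner ℝ (gradient f y) v) U₀ :=
    hgsmooth.continuousOn.inner continuousOn_const
  have hUopen := hvcont.isOpen_inter_preimage hU₀ (isOpen_Ioi (a := (0 : ℝ)))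
  have hnorm : ∀ y ∈ U₀, ‖‖gradient f y‖⁻¹ • gradient f y‖ = 1 := fun y hy =>
    norm_smul_inv_norm (𝕜 := ℝ) (hg y hy)
  have horth : ∀ y ∈ M ∩ U₀, gradient f y ∈ (tangentSpace M y)ᗮ := fun y hy =>
    gradient_mem_orthogonal_tangentSpace hU₀ hz hy
      ((hf.contDiffAt (hU₀.mem_nhds hy.2)).differentiableAt (by simp))
  -- On this open set ∇f has positive pairing with v, as n does along M; this alone fixes the sign
  -- of the normal.
  refine ⟨U₀ ∩ (fun y => inner ℝ (gradient f y) v) ⁻¹' Set.Ioi 0,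
    fun y => ‖gradient f y‖⁻¹ • gradient f y, ⟨hxU₀, hxv⟩,
    ⟨hUopen, ?_, fun y hy => hnorm y hy.1, ?_, ?_⟩, ?_⟩
  · have hgU := hgsmooth.mono (Set.inter_subset_left
      (t := (fun y => inner ℝ (gradient f y) v) ⁻¹' Set.Ioi 0))
    exact ((hgU.norm ℝ fun y hy => hg y hy.1).inv
      fun y hy => norm_ne_zero_iff.2 (hg y hy.1)).smul hgU
  · intro y hy
    apply Submodule.eq_of_le_of_finrank_eq
    · rw [Submodule.le_orthogonal_iff_le_orthogonal, Submodule.span_singleton_le_iff_mem]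
      exact Submodule.smul_mem _ _ (horth y ⟨hy.1, hy.2.1⟩)
    · have hne : ‖gradient f y‖⁻¹ • gradient f y ≠ 0 := fun h => by
        simpa [h] using hnorm y hy.2.1
      have h1 := (ℝ ∙ (‖gradient f y‖⁻¹ • gradient f y)).finrank_add_finrank_orthogonal
      rw [finrank_span_singleton hne, finrank_euclideanSpace_fin] at h1
      rw [hfr y hy.1]
      omega
  · intro y hy a ha b hb
    have hfy := hf.contDiffAt (hU₀.mem_nhds hy.2.1)
    have hor := horth y ⟨hy.1, hy.2.1⟩
    rw [inner_fderiv_normalize_gradient hfy (hg y hy.2.1)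
        (Submodule.inner_left_of_mem_orthogonal hb hor),
      inner_fderiv_normalize_gradient hfy (hg y hy.2.1)
        (Submodule.inner_left_of_mem_orthogonal ha hor),
      (hfy.isSymmSndFDerivAt (by simpa using ENat.LEInfty.out)).eq a b]
  · intro y hy
    obtain ⟨c, hc⟩ := hcoll y hy.1 _ (horth y ⟨hy.1, hy.2.1⟩)
    have hpos : 0 < c := by
      have h1 : 0 < inner ℝ (gradient f y) v := hy.2.2
      rw [hc, inner_smul_left] at h1
      exact pos_of_mul_pos_left (by simpa using h1) (hv y hy.1).le
    simp only [hc, norm_smul, hn1 y hy.1, Real.norm_of_nonneg hpos.le, mul_one]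
    rw [smul_smul, inv_mul_cancel₀ hpos.ne', one_smul]

/-! ### Calculus of the extended normal field -/

namespace IsLocalUnitNormal

variable {d : ℕ} {M U : Set (EuclideanSpace ℝ (Fin d))}
  {N : EuclideanSpace ℝ (Fin d) → EuclideanSpace ℝ (Fin d)} {y v : EuclideanSpace ℝ (Fin d)}

theorem hasFDerivAt (h : IsLocalUnitNormal M U N) (hy : y ∈ U) :
    HasFDerivAt N (fderiv ℝ N y) y :=
  ((h.contDiffOn.contDiffAt (h.isOpen.mem_nhds hy)).differentiableAt (by simp)).hasFDerivAt

theorem hasFDerivAt_fderiv (h : IsLocalUnitNormal M U N) (hy : y ∈ U) :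
    HasFDerivAt (fderiv ℝ N) (fderiv ℝ (fderiv ℝ N) y) y :=
  (((h.contDiffOn.contDiffAt (h.isOpen.mem_nhds hy)).fderiv_right (m := 1)
    (by norm_num; exact ENat.LEInfty.out)).differentiableAt (by simp)).hasFDerivAt

theorem fderiv_fderiv_comm (h : IsLocalUnitNormal M U N) (hy : y ∈ U)
    (a b : EuclideanSpace ℝ (Fin d)) :
    fderiv ℝ (fderiv ℝ N) y a b = fderiv ℝ (fderiv ℝ N) y b a :=
  ((h.contDiffOn.contDiffAt (h.isOpen.mem_nhds hy)).isSymmSndFDerivAt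
    (by simpa using ENat.LEInfty.out)).eq a b

theorem hasFDerivAt_inner_const (h : IsLocalUnitNormal M U N) (hy : y ∈ U)
    (v : EuclideanSpace ℝ (Fin d)) :
    HasFDerivAt (fun z => inner ℝ (N z) v) ((innerSL ℝ v).comp (fderiv ℝ N y)) y := by
  have := (innerSL ℝ v).hasFDerivAt.comp y (h.hasFDerivAt hy)
  refine this.congr_of_eventuallyEq (Filter.Eventually.of_forall fun z => ?_)
  simp [real_inner_comm]

theorem inner_fderiv_self (h : IsLocalUnitNormal M U N) (hy : y ∈ U)
    (a : EuclideanSpace ℝ (Fin d)) : inner ℝ (N y) (fderiv ℝ N y a) = 0 := by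
  have h1 : (fun z => inner ℝ (N z) (N z)) =ᶠ[𝓝 y] fun _ => (1 : ℝ) := by
    filter_upwards [h.isOpen.mem_nhds hy] with z hz
    simp [h.norm_eq_one z hz]
  have hd := (h.hasFDerivAt hy).differentiableAt
  have h2 := fderiv_inner_apply ℝ hd hd a
  rw [h1.fderiv_eq, real_inner_comm (N y) (fderiv ℝ N y a)] at h2
  simp only [fderiv_fun_const, Pi.zero_apply, _root_.zero_apply] at h2
  linarith

/-- Differentiates |N|² = 1 twice. It evaluates the normal entry of the trace of D²N. -/
theorem inner_fderiv_fderiv (h : IsLocalUnitNormal M U N) (hy : y ∈ U)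
    (a b : EuclideanSpace ℝ (Fin d)) :
    inner ℝ (N y) (fderiv ℝ (fderiv ℝ N) y a b) =
      -inner ℝ (fderiv ℝ N y a) (fderiv ℝ N y b) := by
  have h1 : (fun z => inner ℝ (N z) (fderiv ℝ N z b)) =ᶠ[𝓝 y] fun _ => (0 : ℝ) := by
    filter_upwards [h.isOpen.mem_nhds hy] with z hz
    exact h.inner_fderiv_self hz b
  have hd := hasFDerivAt_clm_apply_const (h.hasFDerivAt_fderiv hy) b
  have h2 := fderiv_inner_apply ℝ (h.hasFDerivAt hy).differentiableAt hd.differentiableAt a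
  rw [h1.fderiv_eq, hd.fderiv] at h2
  simp only [fderiv_fun_const, Pi.zero_apply, _root_.zero_apply,
    ContinuousLinearMap.flip_apply] at h2
  linarith

theorem mem_tangentSpace_iff (h : IsLocalUnitNormal M U N) (hy : y ∈ M ∩ U) :
    v ∈ tangentSpace M y ↔ inner ℝ (N y) v = 0 := by
  rw [h.tangentSpace_eq y hy, Submodule.mem_orthogonal_singleton_iff_inner_right]

theorem starProjection_apply (h : IsLocalUnitNormal M U N) (hy : y ∈ M ∩ U)
    (v : EuclideanSpace ℝ (Fin d)) :
    (tangentSpace M y).starProjection v = v - inner ℝ (N y) v • N y := by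
  apply Submodule.eq_starProjection_of_mem_orthogonal
  · rw [h.mem_tangentSpace_iff hy, inner_sub_right, inner_smul_right,
      real_inner_self_eq_norm_sq, h.norm_eq_one y hy.2]
    ring
  · rw [sub_sub_cancel]
    refine Submodule.smul_mem _ _ ((Submodule.mem_orthogonal _ _).2 fun a ha => ?_)
    rw [real_inner_comm]
    exact (h.mem_tangentSpace_iff hy).1 ha

theorem starProjection_orthogonal_apply (h : IsLocalUnitNormal M U N) (hy : y ∈ M ∩ U)
    (v : EuclideanSpace ℝ (Fin d)) :
    (tangentSpace M y)ᗮ.starProjection v = inner ℝ (N y) v • N y := by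
  rw [Submodule.starProjection_orthogonal_val, h.starProjection_apply hy, sub_sub_cancel]

theorem sub_smul_mem_tangentSpace (h : IsLocalUnitNormal M U N) (hy : y ∈ M ∩ U)
    (v : EuclideanSpace ℝ (Fin d)) : v - inner ℝ (N y) v • N y ∈ tangentSpace M y := by
  rw [← h.starProjection_apply hy]
  exact Submodule.starProjection_apply_mem _ _

theorem fderiv_mem_tangentSpace (h : IsLocalUnitNormal M U N) (hy : y ∈ M ∩ U)
    (a : EuclideanSpace ℝ (Fin d)) : fderiv ℝ N y a ∈ tangentSpace M y :=
  (h.mem_tangentSpace_iff hy).2 (h.inner_fderiv_self hy.2 a)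

/-- The shape operator is self-adjoint, as a statement on all of the ambient space. -/
theorem inner_fderiv_eq (h : IsLocalUnitNormal M U N) (hy : y ∈ M ∩ U)
    (v : EuclideanSpace ℝ (Fin d)) {a : EuclideanSpace ℝ (Fin d)} (ha : a ∈ tangentSpace M y) :
    inner ℝ v (fderiv ℝ N y a) = inner ℝ a (fderiv ℝ N y (v - inner ℝ (N y) v • N y)) := by
  rw [real_inner_comm (fderiv ℝ N y (v - inner ℝ (N y) v • N y)) a,
    ← h.symm y hy a ha _ (h.sub_smul_mem_tangentSpace hy v), inner_sub_right, inner_smul_right,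
    real_inner_comm (N y), h.inner_fderiv_self hy.2, mul_zero, sub_zero, real_inner_comm]

theorem eventuallyEq_nhdsWithin {W : Type*} {F G : EuclideanSpace ℝ (Fin d) → W}
    (h : IsLocalUnitNormal M U N) (hy : y ∈ U) (hFG : ∀ z ∈ M ∩ U, F z = G z) :
    F =ᶠ[𝓝[M] y] G := by
  filter_upwards [self_mem_nhdsWithin, mem_nhdsWithin_of_mem_nhds (h.isOpen.mem_nhds hy)]
    with z hz hzU
  exact hFG z ⟨hz, hzU⟩

/-! ### Gradient, divergence and |B|² in terms of DN -/

theorem sum_inner_frame_smul_frame (hv : v ∈ tangentSpace M y) :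
    ∑ j, inner ℝ (frame M y j : EuclideanSpace ℝ (Fin d)) v •
      (frame M y j : EuclideanSpace ℝ (Fin d)) = v := by
  have h1 : (tangentSpace M y).starProjection v = v := Submodule.starProjection_eq_self_iff.2 hv
  conv_rhs => rw [← h1, (frame M y).starProjection_eq_sum_rankOne]
  simp

theorem sum_inner_frame_mul_inner_frame (hv : v ∈ tangentSpace M y)
    (w : EuclideanSpace ℝ (Fin d)) :
    ∑ j, inner ℝ (frame M y j : EuclideanSpace ℝ (Fin d)) v *
      inner ℝ (frame M y j : EuclideanSpace ℝ (Fin d)) w = inner ℝ v w := by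
  conv_rhs => rw [← sum_inner_frame_smul_frame hv, sum_inner]
  simp [inner_smul_left]

/-- The derivative of ln⟨N, v⟩ along a is ⟨v, DN a⟩/⟨N, v⟩, and self-adjointness moves DN onto the
tangential part of v. -/
theorem surfaceGrad_log (h : IsLocalUnitNormal M U N) (hy : y ∈ M ∩ U)
    {φ : EuclideanSpace ℝ (Fin d) → ℝ} (hφ : ∀ z ∈ M ∩ U, φ z = Real.log (inner ℝ (N z) v))
    (hv : inner ℝ (N y) v ≠ 0) :
    surfaceGrad M φ y = (inner ℝ (N y) v)⁻¹ • fderiv ℝ N y (v - inner ℝ (N y) v • N y) := by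
  have hd : ∀ j, dirDeriv M φ y (frame M y j) = (inner ℝ (N y) v)⁻¹ *
      inner ℝ (frame M y j : EuclideanSpace ℝ (Fin d))
        (fderiv ℝ N y (v - inner ℝ (N y) v • N y)) := fun j => by
    rw [dirDeriv_eq_of_eventuallyEq ((h.hasFDerivAt_inner_const hy.2 v).log hv)
      (h.eventuallyEq_nhdsWithin hy.2 hφ) hy.1 (frame M y j).2,
      ← h.inner_fderiv_eq hy v (frame M y j).2]
    simp
  simp only [surfaceGrad, hd, mul_smul]
  rw [← Finset.smul_sum, sum_inner_frame_smul_frame (h.fderiv_mem_tangentSpace hy _)]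

/-- Since ⟨N, DN N⟩ = 0, the normal direction adds nothing to the trace. The fixed basis, unlike the
pointwise chosen frame, lets the trace be differentiated. -/
theorem surfaceDiv_eq_trace (h : IsLocalUnitNormal M U N) (hy : y ∈ M ∩ U)
    {n : EuclideanSpace ℝ (Fin d) → EuclideanSpace ℝ (Fin d)} (hn : ∀ z ∈ M ∩ U, n z = N z) :
    surfaceDiv M n y = ∑ i, inner ℝ (EuclideanSpace.basisFun (Fin d) ℝ i)
      (fderiv ℝ N y (EuclideanSpace.basisFun (Fin d) ℝ i)) := by
  have hd : ∀ j, dirDeriv M n y (frame M y j) = fderiv ℝ N y (frame M y j) := fun j =>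
    dirDeriv_eq_of_eventuallyEq (h.hasFDerivAt hy.2) (h.eventuallyEq_nhdsWithin hy.2 hn) hy.1
      (frame M y j).2
  simp only [surfaceDiv, hd]
  rw [sum_inner_orthonormalBasis_hyperplane (frame M y) (EuclideanSpace.basisFun (Fin d) ℝ)
    (h.starProjection_apply hy), h.inner_fderiv_self hy.2, sub_zero]

/-- If the divergence of the unit normal is constant on `M`, its tangential derivatives vanish. -/
theorem trace_fderiv_fderiv_eq_zero (h : IsLocalUnitNormal M U N) (hy : y ∈ M ∩ U)
    {n : EuclideanSpace ℝ (Fin d) → EuclideanSpace ℝ (Fin d)} (hn : ∀ z ∈ M ∩ U, n z = N z)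
    {c : ℝ} (hc : ∀ z ∈ M, surfaceDiv M n z = c) {a : EuclideanSpace ℝ (Fin d)}
    (ha : a ∈ tangentSpace M y) :
    ∑ i, inner ℝ (EuclideanSpace.basisFun (Fin d) ℝ i)
      (fderiv ℝ (fderiv ℝ N) y a (EuclideanSpace.basisFun (Fin d) ℝ i)) = 0 := by
  have hd : HasFDerivAt (fun z => ∑ i, inner ℝ (EuclideanSpace.basisFun (Fin d) ℝ i)
      (fderiv ℝ N z (EuclideanSpace.basisFun (Fin d) ℝ i)))
      (∑ i, (innerSL ℝ (EuclideanSpace.basisFun (Fin d) ℝ i)).comp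
        ((fderiv ℝ (fderiv ℝ N) y).flip (EuclideanSpace.basisFun (Fin d) ℝ i))) y :=
    HasFDerivAt.fun_sum fun i _ => (innerSL ℝ (EuclideanSpace.basisFun (Fin d) ℝ i)).hasFDerivAt.comp
      y (hasFDerivAt_clm_apply_const (h.hasFDerivAt_fderiv hy.2) _)
  have h1 := dirDeriv_eq_of_eventuallyEq (F := fun _ => c) hd
    (h.eventuallyEq_nhdsWithin hy.2 fun z hz => by
      rw [← hc z hz.1, h.surfaceDiv_eq_trace hz hn]) hy.1 ha
  simpa [dirDeriv, _root_.sum_apply] using h1.symm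

/-- Weingarten: differentiating the projection b - ⟨N, b⟩N gives B(a, b) = -⟨b, DN a⟩N for tangent
a, b. Parseval in b finishes, as DN a is tangent. -/
theorem normSqB_eq (h : IsLocalUnitNormal M U N) (hy : y ∈ M ∩ U) :
    normSqB M y = ∑ j, inner ℝ (fderiv ℝ N y (frame M y j)) (fderiv ℝ N y (frame M y j)) := by
  have hB : ∀ a ∈ tangentSpace M y, ∀ b ∈ tangentSpace M y,
      ‖secondFundamentalForm M y a b‖ ^ 2 =
        inner ℝ b (fderiv ℝ N y a) * inner ℝ b (fderiv ℝ N y a) := by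
    intro a ha b hb
    have hd : HasFDerivAt (fun z => b - inner ℝ (N z) b • N z)
        (-(inner ℝ (N y) b • fderiv ℝ N y +
          ((innerSL ℝ b).comp (fderiv ℝ N y)).smulRight (N y))) y :=
      ((h.hasFDerivAt_inner_const hy.2 b).smul (h.hasFDerivAt hy.2)).const_sub b
    have hb0 := (h.mem_tangentSpace_iff hy).1 hb
    rw [secondFundamentalForm, dirDeriv_eq_of_eventuallyEq hd
      (h.eventuallyEq_nhdsWithin hy.2 fun z hz => h.starProjection_apply hz b) hy.1 ha,
      h.starProjection_orthogonal_apply hy]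
    simp [hb0, inner_smul_right, h.norm_eq_one y hy.2, norm_smul, ← sq]
  rw [normSqB, Finset.sum_comm]
  refine Finset.sum_congr rfl fun l _ => ?_
  simp only [hB _ (frame M y l).2 _ (frame M y _).2]
  exact sum_inner_frame_mul_inner_frame (h.fderiv_mem_tangentSpace hy _) _

/-- The Laplacian of the logarithm of the height of the unit normal over a fixed vector, on a
hypersurface of constant mean curvature. -/
theorem laplaceBeltrami_log (h : IsLocalUnitNormal M U N) (hy : y ∈ M ∩ U)
    {n : EuclideanSpace ℝ (Fin d) → EuclideanSpace ℝ (Fin d)} (hn : ∀ z ∈ M ∩ U, n z = N z)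
    {c : ℝ} (hc : ∀ z ∈ M, surfaceDiv M n z = c)
    {φ : EuclideanSpace ℝ (Fin d) → ℝ} (hφ : ∀ z ∈ M ∩ U, φ z = Real.log (inner ℝ (N z) v))
    (hv : ∀ z ∈ M ∩ U, inner ℝ (N z) v ≠ 0) :
    laplaceBeltrami M φ y = -normSqB M y -
      ‖(inner ℝ (N y) v)⁻¹ • fderiv ℝ N y (v - inner ℝ (N y) v • N y)‖ ^ 2 := by
  set u := inner ℝ (N y) v with hu
  set A := fderiv ℝ N y with hA
  set w := v - u • N y with hw
  have hu0 : u ≠ 0 := hv y hy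
  have hwT : w ∈ tangentSpace M y := h.sub_smul_mem_tangentSpace hy v
  have hdu := h.hasFDerivAt_inner_const hy.2 v
  have hdW : HasFDerivAt (fun z => v - inner ℝ (N z) v • N z)
      (-(u • A + ((innerSL ℝ v).comp A).smulRight (N y))) y :=
    (hdu.smul (h.hasFDerivAt hy.2)).const_sub v
  have hdX := (h.hasFDerivAt_fderiv hy.2).clm_apply hdW
  have hdinv : HasFDerivAt (fun z => (inner ℝ (N z) v)⁻¹)
      (-(u ^ 2)⁻¹ • (innerSL ℝ v).comp A) y :=
    (hasDerivAt_inv hu0).comp_hasFDerivAt y hdu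
  have hdG := hdinv.smul hdX
  -- Product rule for u⁻¹ DN(W), with W the tangential part of v; symmetry of D²N (Codazzi) moves w
  -- into the first slot.
  have hterm : ∀ j, inner ℝ (frame M y j : EuclideanSpace ℝ (Fin d))
      (dirDeriv M (surfaceGrad M φ) y (frame M y j)) =
      u⁻¹ * (inner ℝ (frame M y j : EuclideanSpace ℝ (Fin d))
          (fderiv ℝ (fderiv ℝ N) y w (frame M y j))
        - u * inner ℝ (A (frame M y j)) (A (frame M y j))
        - inner ℝ (frame M y j : EuclideanSpace ℝ (Fin d)) (A w) *
          inner ℝ (frame M y j : EuclideanSpace ℝ (Fin d)) (A (N y)))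
      - (u ^ 2)⁻¹ * (inner ℝ (frame M y j : EuclideanSpace ℝ (Fin d)) (A w) *
          inner ℝ (frame M y j : EuclideanSpace ℝ (Fin d)) (A w)) := fun j => by
    have hj := (frame M y j).2
    rw [dirDeriv_eq_of_eventuallyEq hdG
      (h.eventuallyEq_nhdsWithin hy.2 fun z hz => h.surfaceGrad_log hz hφ (hv z hz)) hy.1 hj]
    have hsym : inner ℝ (frame M y j : EuclideanSpace ℝ (Fin d)) (A (A (frame M y j))) =
        inner ℝ (A (frame M y j)) (A (frame M y j)) := by
      rw [real_inner_comm]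
      exact h.symm y hy _ (h.fderiv_mem_tangentSpace hy _) _ hj
    have hvj : inner ℝ v (A (frame M y j)) =
        inner ℝ (frame M y j : EuclideanSpace ℝ (Fin d)) (A w) := h.inner_fderiv_eq hy v hj
    have hcomm := h.fderiv_fderiv_comm hy.2 w (frame M y j)
    rw [hcomm]
    simp only [_root_.add_apply, _root_.smul_apply,
      _root_.neg_apply, ContinuousLinearMap.smulRight_apply,
      ContinuousLinearMap.comp_apply, ContinuousLinearMap.flip_apply, innerSL_apply_apply,
      map_neg, map_add, map_smul, inner_add_right, inner_neg_right, inner_smul_right,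
      smul_eq_mul, ← hu, ← hA, ← hw, hsym, hvj]
    ring
  -- The full trace of D²N(w, ·) vanishes by constant mean curvature. The normal entry left over
  -- cancels the A N terms in `hterm`, so how N extends off M is immaterial.
  have htr : ∑ j, inner ℝ (frame M y j : EuclideanSpace ℝ (Fin d))
      (fderiv ℝ (fderiv ℝ N) y w (frame M y j)) = inner ℝ (A w) (A (N y)) := by
    rw [sum_inner_orthonormalBasis_hyperplane (frame M y) (EuclideanSpace.basisFun (Fin d) ℝ)
      (h.starProjection_apply hy), h.trace_fderiv_fderiv_eq_zero hy hn hc hwT,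
      h.inner_fderiv_fderiv hy.2]
    ring
  have hAw := h.fderiv_mem_tangentSpace hy w
  rw [laplaceBeltrami, surfaceDiv, Finset.sum_congr rfl fun j _ => hterm j,
    Finset.sum_sub_distrib, ← Finset.mul_sum, ← Finset.mul_sum, Finset.sum_sub_distrib,
    Finset.sum_sub_distrib, ← Finset.mul_sum, htr, ← h.normSqB_eq hy,
    sum_inner_frame_mul_inner_frame hAw, sum_inner_frame_mul_inner_frame hAw, norm_smul, mul_pow,
    real_inner_self_eq_norm_sq, norm_inv, Real.norm_eq_abs, inv_pow, sq_abs]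
  field_simp
  ring

end IsLocalUnitNormal

end HypersurfaceGaussMap

theorem mainTheorem5 (m : ℕ) (M : Set (EuclideanSpace ℝ (Fin (m + 1))))
    (T : EuclideanSpace ℝ (Fin (m + 1)) → ⋀[ℝ]^m (EuclideanSpace ℝ (Fin (m + 1))))
    (I : ⋀[ℝ]^m (EuclideanSpace ℝ (Fin (m + 1))))
    (hM : HypersurfaceGaussMap.IsSmoothSubmanifold m M)
    (hT : HypersurfaceGaussMap.IsGaussMap M T)
    (hH : HypersurfaceGaussMap.HasConstantMeanCurvature M T)
    (hI : HypersurfaceGaussMap.IsUnitBlade I)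
    (hpos : ∀ x ∈ M, 0 < inner ℝ (T x) I) :
    ∀ x ∈ M, HypersurfaceGaussMap.normSqB M x ≤
      -HypersurfaceGaussMap.laplaceBeltrami M (fun y => Real.log (inner ℝ (T y) I)) x := by
  intro x hx
  obtain ⟨n, hn, c, hc⟩ := hH
  obtain ⟨⟨a, rfl⟩, -⟩ := hI
  obtain ⟨v, hv⟩ := HypersurfaceGaussMap.exists_inner_unitNormal_eq hT hn a
  have hpos' : ∀ y ∈ M, 0 < inner ℝ (n y) v := fun y hy => hv y hy ▸ hpos y hy
  obtain ⟨U, N, hxU, hN, hnN⟩ := HypersurfaceGaussMap.exists_isLocalUnitNormal hM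
    (fun y hy => HypersurfaceGaussMap.finrank_tangentSpace_of_isGaussMap hT hy)
    hn.mem_normal hn.norm_eq_one hpos' hx
  -- The constant is `-c` because the mean curvature is minus the divergence of n.
  rw [hN.laplaceBeltrami_log (v := v) (c := -c) ⟨hx, hxU⟩ hnN
    (fun z hz => by rw [← hc z hz, HypersurfaceGaussMap.meanCurvature, neg_neg])
    (fun z hz => by rw [hv z hz.1, hnN z hz])
    (fun z hz => by rw [← hnN z hz]; exact (hpos' z hz.1).ne')]
  rw [neg_sub, sub_neg_eq_add]
  exact le_add_of_nonneg_left (sq_nonneg _)
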